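/- Let $(M,d)$ be a compact metric space with a Borel probability measure $p$ of full support, let $\Omega=M^{\mathbb N}$ carry the product topology, let $\sigma(x_1,x_2,\dots)=(x_2,x_3,\dots)$ be the shift, and let $d_\Omega(x,y)=\sum_{n\ge 1}2^{-n}d(x_n,y_n)$. For $0<\gamma\le 1$ let $C^\gamma(\Omega)$ be the space of functions $\varphi:\Omega\to\mathbb R$ for which there is a constant $C$ with $|\varphi(x)-\varphi(y)|\le C\,d_\Omega(x,y)^\gamma$ for all $x,y$. For $f\in C(\Omega)$ let $$\mathscr L_f\varphi(x)=\int_M e^{f(ax)}\varphi(ax)\,dp(a),\qquad ax=(a,x_1,x_2,\dots),\quad \varphi\in C(\Omega),$$ let $\mathscr L_f^*$ be the dual operator on measures, and let $\lambda_f$ be the supremum of $\mathscr L_f^*\nu(1)$ over the Borel probability measures $\nu$ on $\Omega$ with $\mathscr L_f^*\nu=\mathscr L_f^*\nu(1)\cdot\nu$. Fix $0<\alpha\le 1$ and define the entropy of a Borel probability measure $\mu$ on $\Omega$ by $$h(\mu)=\inf_{g\in C^\alpha(\Omega)}\Big\{-\int_\Omega g\,d\mu+\log\lambda_g\Big\}\in[-\infty,\infty).$$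 A $\sigma$-invariant Borel probability measure $\mu$ is an equilibrium state for $f$ if $h(\mu)+\int f\,d\mu=\sup_\rho\{h(\rho)+\int f\,d\rho\}$, the supremum being over all $\sigma$-invariant Borel probability measures $\rho$ on $\Omega$. Let $f:\Omega\to\mathbb R$ be continuous. (1) Let $(f_n)$ be a sequence of Hölder potentials (each $f_n$ in some $C^{\gamma_n}(\Omega)$, $0<\gamma_n\le 1$) with $\|f_n-f\|_\infty\to 0$. For every $n$ let $\nu_{f_n}$ be a Borel probability measure with $\mathscr L_{f_n}^*\nu_{f_n}=\lambda_{f_n}\nu_{f_n}$, and let $h_{f_n}$ be a strictly positive continuous function with $\mathscr L_{f_n}h_{f_n}=\lambda_{f_n}h_{f_n}$ and $\int h_{f_n}\,d\nu_{f_n}=1$. Then some subsequence of the measures $h_{f_n}\nu_{f_n}$ converges weakly to a Borel probability measure, and every Borel probability measure $\mu_f$ that is the weak limit of a subsequence of $(h_{f_n}\nu_{f_n})$ is $\sigma$-invariant and is an equilibrium state for $f$. (2) $\displaystyle \log\lambda_f=\sup_{\rho\ \sigma\text{-invariant}}\Big\{h(\rho)+\int_\Omega f\,d\rho\Big\}.$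 -/

import Mathlib

open MeasureTheory Filter Topology

namespace RuelleThermo

variable {M : Type*}

/-- The left shift `(x₁, x₂, …) ↦ (x₂, x₃, …)` on `M^ℕ` (coordinates are indexed from `0`). -/
def shift (x : ℕ → M) : ℕ → M := fun n => x (n + 1)

/-- The concatenation `ax = (a, x₁, x₂, …)`. -/
def prepend (a : M) (x : ℕ → M) : ℕ → M
  | 0 => a
  | n + 1 => x n

theorem continuous_prepend [TopologicalSpace M] :
    Continuous (fun q : M × (ℕ → M) => prepend q.1 q.2) := by
  refine continuous_pi fun n => ?_
  cases n with
  | zero => exact continuous_fst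
  | succ n => exact (continuous_apply n).comp continuous_snd

/-- The distance `d_Ω(x, y) = ∑_{n ≥ 1} 2^{-n} d(x_n, y_n)` on `M^ℕ`. -/
noncomputable def distΩ [MetricSpace M] (x y : ℕ → M) : ℝ :=
  ∑' n : ℕ, (1 / 2 : ℝ) ^ (n + 1) * dist (x n) (y n)

section Operator

variable [MetricSpace M] [CompactSpace M] [MeasurableSpace M] [BorelSpace M]

/-- The space `C^γ(Ω)` of `γ`-Hölder functions with respect to `d_Ω`. -/
def holderClass (M : Type*) [MetricSpace M] (γ : ℝ) : Set C(ℕ → M, ℝ) :=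
  {φ | ∃ C : ℝ, ∀ x y : ℕ → M, |φ x - φ y| ≤ C * distΩ x y ^ γ}

/-- The Ruelle operator `(L_f φ)(x) = ∫_M exp(f(ax)) φ(ax) dp(a)` on `C(Ω)`. -/
noncomputable def ruelle (p : Measure M) [IsProbabilityMeasure p] (f φ : C(ℕ → M, ℝ)) :
    C(ℕ → M, ℝ) where
  toFun x := ∫ a, Real.exp (f (prepend a x)) * φ (prepend a x) ∂p
  continuous_toFun := by
    let F : C(ℕ → M, ℝ) := ⟨fun y => Real.exp (f y) * φ y, by fun_prop⟩
    have hF : ∀ a x, Real.exp (f (prepend a x)) * φ (prepend a x) = F (prepend a x) :=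
      fun _ _ => rfl
    simp only [hF]
    refine continuous_of_dominated (bound := fun _ => ‖F‖) (fun x => ?_) (fun x => ?_)
      (integrable_const _) ?_
    · exact (F.continuous.comp (continuous_prepend.comp
        (continuous_id.prodMk continuous_const))).aestronglyMeasurable
    · exact Eventually.of_forall fun a => F.norm_coe_le_norm _
    · exact Eventually.of_forall fun a => F.continuous.comp (continuous_prepend.comp
        (continuous_const.prodMk continuous_id))

/-- `L_f^* ν = c • ν`, where the dual operator `L_f^*` is given by the duality relation
`∫ φ d(L_f^* ν) = ∫ L_f φ dν` for all `φ ∈ C(Ω)`. -/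
def IsDualEigen (p : Measure M) [IsProbabilityMeasure p] (f : C(ℕ → M, ℝ)) (c : ℝ)
    (ν : ProbabilityMeasure (ℕ → M)) : Prop :=
  ∀ φ : C(ℕ → M, ℝ), ∫ x, ruelle p f φ x ∂(ν : Measure (ℕ → M)) =
    c * ∫ x, φ x ∂(ν : Measure (ℕ → M))

/-- The total mass `L_f^*(ν)(1) = ∫ L_f 1 dν`. -/
noncomputable def dualMass (p : Measure M) [IsProbabilityMeasure p] (f : C(ℕ → M, ℝ))
    (ν : ProbabilityMeasure (ℕ → M)) : ℝ :=
  ∫ x, ruelle p f 1 x ∂(ν : Measure (ℕ → M))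

/-- `λ_f`, the supremum of `L_f^*(ν)(1)` over the probability measures `ν` that are fixed by
`ν ↦ L_f^*(ν) / L_f^*(ν)(1)`. -/
noncomputable def eigenvalue (p : Measure M) [IsProbabilityMeasure p]
    (f : C(ℕ → M, ℝ)) : ℝ :=
  sSup {c : ℝ | ∃ ν : ProbabilityMeasure (ℕ → M),
    IsDualEigen p f (dualMass p f ν) ν ∧ c = dualMass p f ν}

/-- `ν ∈ 𝒢^*(f)`: a probability measure with `L_f^* ν = λ_f ν`. -/
def IsEigenprobability (p : Measure M) [IsProbabilityMeasure p] (f : C(ℕ → M, ℝ))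
    (ν : ProbabilityMeasure (ℕ → M)) : Prop :=
  IsDualEigen p f (eigenvalue p f) ν

/-- `h` is a main eigenfunction: strictly positive, with `L_f h = λ_f h`. -/
def IsMainEigenfunction (p : Measure M) [IsProbabilityMeasure p] (f h : C(ℕ → M, ℝ)) :
    Prop :=
  (∀ x, 0 < h x) ∧ ruelle p f h = eigenvalue p f • h

/-- The set of shift-invariant Borel probability measures on `Ω`. -/
def invariantMeasures (M : Type*) [MeasurableSpace M] :
    Set (ProbabilityMeasure (ℕ → M)) :=
  {ρ | MeasurePreserving shift (ρ : Measure (ℕ → M)) (ρ : Measure (ℕ → M))}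

/-- The entropy `h(μ) = inf_{g ∈ C^α(Ω)} (-∫ g dμ + log λ_g)`, which may be `-∞`. -/
noncomputable def entropy (p : Measure M) [IsProbabilityMeasure p] (α : ℝ)
    (μ : ProbabilityMeasure (ℕ → M)) : EReal :=
  ⨅ g ∈ holderClass M α,
    ((-∫ x, g x ∂(μ : Measure (ℕ → M)) + Real.log (eigenvalue p g) : ℝ) : EReal)

/-- `h(ρ) + ∫ f dρ`. -/
noncomputable def freeEnergy (p : Measure M) [IsProbabilityMeasure p] (α : ℝ)
    (f : C(ℕ → M, ℝ)) (ρ : ProbabilityMeasure (ℕ → M)) : EReal :=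
  entropy p α ρ + ((∫ x, f x ∂(ρ : Measure (ℕ → M)) : ℝ) : EReal)

/-- The supremum of `h(ρ) + ∫ f dρ` over the shift-invariant probability measures `ρ`. -/
noncomputable def variationalPressure (p : Measure M) [IsProbabilityMeasure p] (α : ℝ)
    (f : C(ℕ → M, ℝ)) : EReal :=
  ⨆ ρ ∈ invariantMeasures M, freeEnergy p α f ρ

/-- A shift-invariant probability measure that attains the variational supremum. -/
def IsEquilibriumState (p : Measure M) [IsProbabilityMeasure p] (α : ℝ)
    (f : C(ℕ → M, ℝ)) (μ : ProbabilityMeasure (ℕ → M)) : Prop :=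
  μ ∈ invariantMeasures M ∧ freeEnergy p α f μ = variationalPressure p α f

/-- `μ` is the weak limit of a subsequence of the measures `h_n ν_n`. -/
def IsWeakClusterPoint (h : ℕ → C(ℕ → M, ℝ)) (ν : ℕ → ProbabilityMeasure (ℕ → M))
    (μ : ProbabilityMeasure (ℕ → M)) : Prop :=
  ∃ k : ℕ → ℕ, StrictMono k ∧ ∀ φ : C(ℕ → M, ℝ),
    Tendsto (fun j => ∫ x, φ x * h (k j) x ∂(ν (k j) : Measure (ℕ → M))) atTop
      (𝓝 (∫ x, φ x ∂(μ : Measure (ℕ → M))))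

end Operator

end RuelleThermo

/-!
The proof rests on a min-max description of `λ_f` that needs no regularity of `f`. Let the
*pressure* `P(f)` be the infimum of the `s` for which some positive continuous `u` satisfies
`L_f u ≤ e^s u`. With `u = e^w` this inequality reads
`∫ exp ((f + w - w ∘ σ) (ax)) dp(a) ≤ e^s`, so `P` is convex (`convexOn_pressure`), is `1`-Lipschitz
for the supremum norm (`lipschitzWith_pressure`), and does not grow when a coboundary `ψ - ψ ∘ σ`
is added to `f` (`pressure_add_coboundary_le`).

*`λ_f = e^{P(f)}`* (`eigenvalue_eq_exp_pressure`). Integrating `L_f u ≤ e^s u` shows that every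
eigenprobability has eigenvalue at most `e^{P(f)}`. Conversely no continuous `ψ`, of either sign,
satisfies `L_f ψ < e^{P(f)} ψ` everywhere (`exists_exp_pressure_mul_le_ruelle`), and then
Hahn–Banach separation and the Riesz–Markov–Kakutani theorem give a probability measure that
annihilates the range of `L_f - e^{P(f)}`.

*Subgradients of `P` are equilibrium states.* Let `P(f) + ∫ (g - f) dμ ≤ P(g)` for all continuous
`g`. Taking `g = f + (ψ - ψ ∘ σ)` shows that `μ` is invariant. Taking `g` Hölder shows that
`h(μ) + ∫ f dμ ≥ P(f)`. The reverse inequality holds for every probability measure because Hölder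
functions are dense (`freeEnergy_le_pressure`). A subgradient exists by convexity of `P`
(`exists_isPressureSubgradient`), so the supremum of the free energy is `P(f) = log λ_f`.

*Limits of `h ν`.* If `L_F h = λ_F h`, `L_F^* ν = λ_F ν` and `∫ h dν = 1`, one application of Jensen's
inequality to the normalised operator `φ ↦ L_F (h φ) / (λ_F h)` shows that `h ν` is a subgradient
of `P` at `F` (`pressure_add_integral_sub_mul_le`). The subgradient inequality passes to uniform
limits of the potentials and weak limits of the measures, and the space of probability measures on
the compact metrizable space `M^ℕ` is sequentially compact.
-/

namespace RuelleThermo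

/-! ### Separation by probability measures -/

section Separation

variable {X : Type*} [TopologicalSpace X] [CompactSpace X] [MeasurableSpace X] [BorelSpace X]

theorem integrable_continuousMap (μ : Measure X) [IsFiniteMeasure μ] (φ : C(X, ℝ)) :
    Integrable φ μ :=
  φ.continuous.integrable_of_hasCompactSupport (HasCompactSupport.of_compactSpace _)

/-- The Riesz–Markov–Kakutani theorem for states on `C(X)`, `X` a compact Hausdorff space. -/
theorem exists_probabilityMeasure_integral_eq [T2Space X] (Λ : C(X, ℝ) →ₗ[ℝ] ℝ)
    (hpos : ∀ φ, 0 ≤ φ → 0 ≤ Λ φ) (hone : Λ 1 = 1) :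
    ∃ μ : ProbabilityMeasure X, ∀ φ : C(X, ℝ), ∫ x, φ x ∂(μ : Measure X) = Λ φ := by
  let Λc : CompactlySupportedContinuousMap X ℝ →ₚ[ℝ] ℝ := PositiveLinearMap.mk₀
    { toFun := fun φ => Λ φ.toContinuousMap
      map_add' := fun φ ψ => Λ.map_add φ.toContinuousMap ψ.toContinuousMap
      map_smul' := fun c φ => Λ.map_smul c φ.toContinuousMap }
    (fun φ hφ => hpos _ fun x => hφ x)
  have hint : ∀ φ : C(X, ℝ), ∫ x, φ x ∂(RealRMK.rieszMeasure Λc) = Λ φ := fun φ =>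
    RealRMK.integral_rieszMeasure Λc (CompactlySupportedContinuousMap.continuousMapEquiv φ)
  have hprob : IsProbabilityMeasure (RealRMK.rieszMeasure Λc) := by
    have h := hint 1
    simp only [ContinuousMap.one_apply, integral_const, smul_eq_mul, mul_one, hone] at h
    exact ⟨by simpa [Measure.real, ENNReal.toReal_eq_one_iff] using h⟩
  exact ⟨⟨_, hprob⟩, hint⟩

/-- Hahn–Banach separation in `C(X)` by a probability measure: because the convex set `S` is a
lower set, a functional that separates it from `0` is automatically positive. -/
theorem exists_probabilityMeasure_integral_neg [T2Space X] {S : Set C(X, ℝ)}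
    (hconv : Convex ℝ S) (hopen : IsOpen S) (hlower : IsLowerSet S) (hne : S.Nonempty)
    (hzero : (0 : C(X, ℝ)) ∉ S) :
    ∃ μ : ProbabilityMeasure X, ∀ φ ∈ S, ∫ x, φ x ∂(μ : Measure X) < 0 := by
  obtain ⟨Λ, hΛ⟩ := geometric_hahn_banach_open_point hconv hopen hzero
  simp only [map_zero] at hΛ
  obtain ⟨θ, hθ⟩ := hne
  have hpos : ∀ φ : C(X, ℝ), 0 ≤ φ → 0 ≤ Λ φ := by
    intro φ hφ
    by_contra! hneg
    -- `θ - tφ` stays in `S` for every `t ≥ 0`; this `t` makes `Λ` vanish on it.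
    have ht : 0 ≤ Λ θ / Λ φ := (div_pos_of_neg_of_neg (hΛ θ hθ) hneg).le
    have hmem : θ - (Λ θ / Λ φ) • φ ∈ S :=
      hlower (sub_le_self θ (smul_nonneg ht hφ)) hθ
    have := hΛ _ hmem
    rw [map_sub, map_smul, smul_eq_mul, div_mul_cancel₀ _ hneg.ne, sub_self] at this
    exact lt_irrefl _ this
  have hone : 0 < Λ 1 := by
    have hmem : -(‖θ‖ • (1 : C(X, ℝ))) ∈ S := by
      refine hlower (fun x => ?_) hθ
      have := neg_le_of_abs_le (θ.norm_coe_le_norm x)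
      simpa using this
    have h := hΛ _ hmem
    rw [map_neg, map_smul, smul_eq_mul, neg_lt_zero] at h
    exact pos_of_mul_pos_right h (norm_nonneg _)
  obtain ⟨μ, hμ⟩ := exists_probabilityMeasure_integral_eq ((Λ 1)⁻¹ • (Λ : C(X, ℝ) →ₗ[ℝ] ℝ))
    (fun φ hφ => mul_nonneg (inv_nonneg.2 hone.le) (hpos φ hφ)) (by simp [hone.ne'])
  refine ⟨μ, fun φ hφ => ?_⟩
  rw [hμ]
  exact mul_neg_of_pos_of_neg (inv_pos.2 hone) (hΛ φ hφ)

end Separation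

/-! ### The pressure -/

section Pressure

variable {M : Type*} [MetricSpace M]

theorem continuous_shift : Continuous (shift : (ℕ → M) → ℕ → M) :=
  continuous_pi fun n => continuous_apply (n + 1)

/-- The coboundary `w - w ∘ σ`. -/
def coboundary (w : C(ℕ → M, ℝ)) : C(ℕ → M, ℝ) :=
  w - w.comp ⟨shift, continuous_shift⟩

@[simp]
theorem coboundary_prepend (w : C(ℕ → M, ℝ)) (a : M) (x : ℕ → M) :
    coboundary w (prepend a x) = w (prepend a x) - w x := rfl

/-- The function `exp ∘ w`. -/
noncomputable def expMap (w : C(ℕ → M, ℝ)) : C(ℕ → M, ℝ) :=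
  ⟨fun x => Real.exp (w x), by fun_prop⟩

@[simp]
theorem expMap_apply (w : C(ℕ → M, ℝ)) (x : ℕ → M) : expMap w x = Real.exp (w x) := rfl

/-- The function `log ∘ u` of a positive continuous function `u`. -/
noncomputable def logMap (u : C(ℕ → M, ℝ)) (hu : ∀ x, 0 < u x) : C(ℕ → M, ℝ) :=
  ⟨fun x => Real.log (u x), u.continuous.log fun x => (hu x).ne'⟩

@[simp]
theorem logMap_apply (u : C(ℕ → M, ℝ)) (hu : ∀ x, 0 < u x) (x : ℕ → M) :
    logMap u hu x = Real.log (u x) := rfl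

variable [MeasurableSpace M] (p : Measure M)

/-- `IsSubaction p f s w` says that `u = e^w` satisfies `L_f u ≤ e^s u`. The inequality
is divided by `u`, which makes it a convex condition on `(f, s, w)`. -/
def IsSubaction (f : C(ℕ → M, ℝ)) (s : ℝ) (w : C(ℕ → M, ℝ)) : Prop :=
  ∀ x, ∫ a, Real.exp ((f + coboundary w) (prepend a x)) ∂p ≤ Real.exp s

variable {p} in
theorem IsSubaction.add_coboundary {f w : C(ℕ → M, ℝ)} {s : ℝ}
    (h : IsSubaction p f s w) (ψ : C(ℕ → M, ℝ)) :
    IsSubaction p (f + coboundary ψ) s (w - ψ) := by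
  intro x
  convert h x using 4
  simp only [ContinuousMap.add_apply, coboundary_prepend, ContinuousMap.sub_apply]
  ring

variable [CompactSpace M] [BorelSpace M] [IsProbabilityMeasure p]

theorem integrable_comp_prepend (φ : C(ℕ → M, ℝ)) (x : ℕ → M) :
    Integrable (fun a => φ (prepend a x)) p :=
  integrable_continuousMap p
    ⟨_, φ.continuous.comp (continuous_prepend.comp (continuous_id.prodMk continuous_const))⟩

theorem integrable_exp_mul_prepend (f φ : C(ℕ → M, ℝ)) (x : ℕ → M) :
    Integrable (fun a => Real.exp (f (prepend a x)) * φ (prepend a x)) p :=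
  integrable_comp_prepend p (expMap f * φ) x

theorem ruelle_apply (f φ : C(ℕ → M, ℝ)) (x : ℕ → M) :
    ruelle p f φ x = ∫ a, Real.exp (f (prepend a x)) * φ (prepend a x) ∂p := rfl

theorem ruelle_add (f φ ψ : C(ℕ → M, ℝ)) :
    ruelle p f (φ + ψ) = ruelle p f φ + ruelle p f ψ := by
  ext x
  simp only [ruelle_apply, ContinuousMap.add_apply, mul_add]
  exact integral_add (integrable_exp_mul_prepend p f φ x) (integrable_exp_mul_prepend p f ψ x)

theorem ruelle_smul (f : C(ℕ → M, ℝ)) (c : ℝ) (φ : C(ℕ → M, ℝ)) :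
    ruelle p f (c • φ) = c • ruelle p f φ := by
  ext x
  simp only [ruelle_apply, ContinuousMap.smul_apply, smul_eq_mul, mul_left_comm _ c,
    integral_const_mul]

theorem ruelle_neg (f φ : C(ℕ → M, ℝ)) : ruelle p f (-φ) = -ruelle p f φ := by
  rw [← neg_one_smul ℝ φ, ruelle_smul, neg_one_smul]

theorem ruelle_mono (f : C(ℕ → M, ℝ)) {φ ψ : C(ℕ → M, ℝ)} (h : ∀ x, φ x ≤ ψ x)
    (x : ℕ → M) : ruelle p f φ x ≤ ruelle p f ψ x :=
  integral_mono (integrable_exp_mul_prepend p f φ x) (integrable_exp_mul_prepend p f ψ x)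
    fun _ => mul_le_mul_of_nonneg_left (h _) (Real.exp_pos _).le

/-- The pressure of `f`: the infimum of all `s` for which some positive continuous `u` satisfies
`L_f u ≤ e^s u`. -/
noncomputable def pressure (f : C(ℕ → M, ℝ)) : ℝ :=
  sInf {s | ∃ w, IsSubaction p f s w}

variable {p} {f g w v : C(ℕ → M, ℝ)} {s r : ℝ}

theorem ruelle_expMap (f w : C(ℕ → M, ℝ)) (x : ℕ → M) :
    ruelle p f (expMap w) x =
      (∫ a, Real.exp ((f + coboundary w) (prepend a x)) ∂p) * Real.exp (w x) := by
  rw [ruelle_apply, ← integral_mul_const]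
  refine integral_congr_ae (Eventually.of_forall fun a => ?_)
  simp only [ContinuousMap.add_apply, coboundary_prepend, expMap_apply, ← Real.exp_add]
  ring_nf

theorem isSubaction_iff :
    IsSubaction p f s w ↔ ∀ x, ruelle p f (expMap w) x ≤ Real.exp s * Real.exp (w x) := by
  simp only [ruelle_expMap, IsSubaction, mul_le_mul_iff_left₀ (Real.exp_pos _)]

theorem IsSubaction.of_le_add (h : IsSubaction p g s w) {c : ℝ} (hfg : ∀ x, f x ≤ g x + c) :
    IsSubaction p f (s + c) w := by
  intro x
  have hint (k : C(ℕ → M, ℝ)) := integrable_comp_prepend p (expMap (k + coboundary w)) x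
  calc ∫ a, Real.exp ((f + coboundary w) (prepend a x)) ∂p
      ≤ ∫ a, Real.exp ((g + coboundary w) (prepend a x)) * Real.exp c ∂p := by
        refine integral_mono (hint f) ((hint g).mul_const _) fun a => ?_
        simp only [ContinuousMap.add_apply, ← Real.exp_add]
        exact Real.exp_le_exp.2 (by linarith [hfg (prepend a x)])
    _ ≤ Real.exp (s + c) := by
        rw [integral_mul_const, Real.exp_add]
        exact mul_le_mul_of_nonneg_right (h x) (Real.exp_pos _).le

theorem IsSubaction.convexComb (hf : IsSubaction p f s w) (hg : IsSubaction p g r v) {t t' : ℝ}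
    (ht : 0 ≤ t) (ht' : 0 ≤ t') (htt : t + t' = 1) :
    IsSubaction p (t • f + t' • g) (t * s + t' * r) (t • w + t' • v) := by
  intro x
  have hint (k u : C(ℕ → M, ℝ)) := integrable_comp_prepend p (expMap (k + coboundary u)) x
  simp only [expMap_apply] at hint
  -- Convexity of `exp` is applied to the potentials normalised by their bounds `s` and `r`.
  have hle : (∫ a, Real.exp ((t • f + t' • g + coboundary (t • w + t' • v)) (prepend a x)) ∂p)
      * Real.exp (-(t * s + t' * r)) ≤
      t * ((∫ a, Real.exp ((f + coboundary w) (prepend a x)) ∂p) * Real.exp (-s)) +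
      t' * ((∫ a, Real.exp ((g + coboundary v) (prepend a x)) ∂p) * Real.exp (-r)) := by
    simp only [← integral_mul_const, ← integral_const_mul]
    rw [← integral_add (((hint f w).mul_const _).const_mul t)
      (((hint g v).mul_const _).const_mul t')]
    refine integral_mono ((hint _ _).mul_const _) ((((hint f w).mul_const _).const_mul t).add
      (((hint g v).mul_const _).const_mul t')) fun a => ?_
    have := convexOn_exp.2 (Set.mem_univ (f (prepend a x) + (w (prepend a x) - w x) - s))
      (Set.mem_univ (g (prepend a x) + (v (prepend a x) - v x) - r)) ht ht' htt
    simp only [smul_eq_mul] at this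
    simp only [ContinuousMap.add_apply, coboundary_prepend,
      ContinuousMap.smul_apply, smul_eq_mul, ← Real.exp_add, ← sub_eq_add_neg]
    convert this using 2
    ring
  have h1 : (∫ a, Real.exp ((f + coboundary w) (prepend a x)) ∂p) * Real.exp (-s) ≤ 1 := by
    rw [Real.exp_neg, ← div_eq_mul_inv, div_le_one (Real.exp_pos _)]
    exact hf x
  have h2 : (∫ a, Real.exp ((g + coboundary v) (prepend a x)) ∂p) * Real.exp (-r) ≤ 1 := by
    rw [Real.exp_neg, ← div_eq_mul_inv, div_le_one (Real.exp_pos _)]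
    exact hg x
  rw [← div_le_one (Real.exp_pos _), div_eq_mul_inv, ← Real.exp_neg]
  refine hle.trans ?_
  nlinarith

theorem isSubaction_zero (f : C(ℕ → M, ℝ)) : IsSubaction p f ‖f‖ 0 := by
  have h0 : IsSubaction p (0 : C(ℕ → M, ℝ)) 0 0 := by
    intro x
    simp [coboundary]
  simpa using h0.of_le_add (f := f) (c := ‖f‖) fun x => by
    simpa using (le_abs_self _).trans (f.norm_coe_le_norm x)

/-- Evaluation of the inequality at a minimum of `w` bounds `s` from below. -/
theorem IsSubaction.neg_norm_le (h : IsSubaction p f s w) : -‖f‖ ≤ s := by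
  have : Nonempty M := p.nonempty_of_neZero
  obtain ⟨x, hx⟩ := w.continuous.exists_forall_le_of_hasCompactSupport
    (HasCompactSupport.of_compactSpace _)
  have hle : Real.exp (-‖f‖) ≤ Real.exp s := by
    refine le_trans ?_ (h x)
    calc Real.exp (-‖f‖) = ∫ _, Real.exp (-‖f‖) ∂p := by simp
      _ ≤ _ := by
        refine integral_mono (integrable_const _)
          (integrable_comp_prepend p (expMap (f + coboundary w)) x) fun a => ?_
        refine Real.exp_le_exp.2 ?_
        have := neg_le_of_abs_le (f.norm_coe_le_norm (prepend a x))
        simp only [ContinuousMap.add_apply, coboundary_prepend]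
        linarith [hx (prepend a x)]
  exact Real.exp_le_exp.1 hle

theorem bddBelow_isSubaction (f : C(ℕ → M, ℝ)) :
    BddBelow {s | ∃ w, IsSubaction p f s w} :=
  ⟨-‖f‖, fun _ ⟨_, h⟩ => h.neg_norm_le⟩

theorem nonempty_isSubaction (f : C(ℕ → M, ℝ)) :
    {s | ∃ w, IsSubaction p f s w}.Nonempty :=
  ⟨‖f‖, 0, isSubaction_zero f⟩

theorem IsSubaction.pressure_le (h : IsSubaction p f s w) : pressure p f ≤ s :=
  csInf_le (bddBelow_isSubaction f) ⟨w, h⟩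

theorem le_pressure (h : ∀ s w, IsSubaction p f s w → r ≤ s) : r ≤ pressure p f :=
  by
  refine le_csInf (nonempty_isSubaction f) ?_
  rintro s ⟨w, hw⟩
  exact h s w hw

theorem exists_isSubaction_of_pressure_lt (h : pressure p f < s) :
    ∃ w, IsSubaction p f s w := by
  obtain ⟨r, ⟨w, hw⟩, hr⟩ := exists_lt_of_csInf_lt (nonempty_isSubaction f) h
  exact ⟨w, fun x => (hw x).trans (Real.exp_le_exp.2 hr.le)⟩

theorem pressure_le_add {c : ℝ} (hfg : ∀ x, f x ≤ g x + c) :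
    pressure p f ≤ pressure p g + c := by
  rw [← sub_le_iff_le_add]
  exact le_pressure fun s w h => by linarith [(h.of_le_add hfg).pressure_le]

theorem pressure_add_coboundary_le (f ψ : C(ℕ → M, ℝ)) :
    pressure p (f + coboundary ψ) ≤ pressure p f :=
  le_pressure fun _ _ h => (h.add_coboundary ψ).pressure_le

theorem pressure_le_add_norm (f g : C(ℕ → M, ℝ)) : pressure p f ≤ pressure p g + ‖f - g‖ :=
  pressure_le_add fun x => by
    have := (le_abs_self _).trans ((f - g).norm_coe_le_norm x)
    simp only [ContinuousMap.sub_apply] at this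
    linarith

variable (p)

theorem lipschitzWith_pressure : LipschitzWith 1 (pressure (M := M) p) :=
  LipschitzWith.of_le_add fun f g => by
    rw [dist_eq_norm]
    exact pressure_le_add_norm f g

theorem convexOn_pressure : ConvexOn ℝ Set.univ (pressure (M := M) p) := by
  refine ⟨convex_univ, fun f _ g _ t t' ht ht' htt => le_of_forall_pos_le_add fun ε hε => ?_⟩
  obtain ⟨w, hw⟩ := exists_isSubaction_of_pressure_lt (lt_add_of_pos_right (pressure p f) hε)
  obtain ⟨v, hv⟩ := exists_isSubaction_of_pressure_lt (lt_add_of_pos_right (pressure p g) hε)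
  refine (hw.convexComb hv ht ht' htt).pressure_le.trans (le_of_eq ?_)
  simp only [smul_eq_mul]
  linear_combination ε * htt

end Pressure

/-! ### Eigenprobabilities -/

section Eigenvalue

variable {M : Type*} [MetricSpace M] [CompactSpace M] [MeasurableSpace M] [BorelSpace M]
  {p : Measure M} [IsProbabilityMeasure p]

/-- No continuous `ψ`, of whatever sign, satisfies `L_f ψ < e^{P(f)} ψ` everywhere. For positive
`ψ` this is the definition of the pressure `P(f)`. Otherwise, compare `ψ` with a positive `u` that
satisfies `L_f u ≤ e^s u` with `s` slightly above `P(f)`: at a point where `ψ + tu ≥ 0` vanishes,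
`L_f (ψ + tu)` would be negative. -/
theorem exists_exp_pressure_mul_le_ruelle (f ψ : C(ℕ → M, ℝ)) :
    ∃ x, Real.exp (pressure p f) * ψ x ≤ ruelle p f ψ x := by
  have : Nonempty M := p.nonempty_of_neZero
  by_contra! hlt
  set l := Real.exp (pressure p f) with hl
  have hl0 : 0 < l := Real.exp_pos _
  by_cases hψ : ∀ x, 0 < ψ x
  · have hcont : Continuous fun x => ruelle p f ψ x / ψ x :=
      (ruelle p f ψ).continuous.div ψ.continuous fun x => (hψ x).ne'
    obtain ⟨x₀, -, hx₀⟩ := isCompact_univ.exists_isMaxOn Set.univ_nonempty hcont.continuousOn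
    set k := ruelle p f ψ x₀ / ψ x₀ with hk
    have hkl : k < l := (div_lt_iff₀ (hψ x₀)).2 (hlt x₀)
    -- A bound `q` that is positive, since its logarithm is taken; the sign of `k` does not matter.
    obtain ⟨q, hq, hql⟩ := exists_between (max_lt hl0 hkl)
    have hq0 : 0 < q := (le_max_left _ _).trans_lt hq
    have hsub : IsSubaction p f (Real.log q) (logMap ψ hψ) := by
      rw [isSubaction_iff]
      have hexp : expMap (logMap ψ hψ) = ψ := by
        ext x
        simp [Real.exp_log (hψ x)]
      intro x
      rw [hexp, Real.exp_log hq0, logMap_apply, Real.exp_log (hψ x), ← div_le_iff₀ (hψ x)]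
      exact (hx₀ (Set.mem_univ x)).trans ((le_max_right _ _).trans hq.le)
    have := hsub.pressure_le
    rw [← Real.exp_le_exp, Real.exp_log hq0] at this
    exact absurd hql this.not_gt
  · push Not at hψ
    obtain ⟨z, hz⟩ := hψ
    obtain ⟨x₁, -, hx₁⟩ := isCompact_univ.exists_isMinOn Set.univ_nonempty
      (f := fun x => l * ψ x - ruelle p f ψ x)
      ((continuous_const.mul ψ.continuous).sub (ruelle p f ψ).continuous).continuousOn
    set ε := l * ψ x₁ - ruelle p f ψ x₁ with hε
    have hε0 : 0 < ε := sub_pos.2 (hlt x₁)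
    have hgap : ∀ x, ruelle p f ψ x ≤ l * ψ x - ε := fun x => by
      have := hx₁ (Set.mem_univ x)
      simp only [Set.mem_ofPred_eq] at this
      linarith
    -- `s > P(f)` with `(e^s - e^{P(f)}) ‖ψ‖ < ε`.
    obtain ⟨s, hs, hsε⟩ : ∃ s, pressure p f < s ∧ (Real.exp s - l) * ‖ψ‖ < ε := by
      have hcont : ContinuousAt (fun s => (Real.exp s - l) * ‖ψ‖) (pressure p f) := by fun_prop
      have hev : ∀ᶠ s in 𝓝 (pressure p f), (Real.exp s - l) * ‖ψ‖ < ε :=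
        hcont.eventually_lt continuousAt_const (by simpa [← hl] using hε0)
      have hev' := (hev.filter_mono nhdsWithin_le_nhds).and
        (self_mem_nhdsWithin (s := Set.Ioi (pressure p f)))
      obtain ⟨s, h1, h2⟩ := hev'.exists
      exact ⟨s, h2, h1⟩
    obtain ⟨w, hw⟩ := exists_isSubaction_of_pressure_lt hs
    rw [isSubaction_iff] at hw
    obtain ⟨x₀, -, hx₀⟩ := isCompact_univ.exists_isMinOn Set.univ_nonempty
      (f := fun x => ψ x * Real.exp (-w x)) (by fun_prop)
    set t := -(ψ x₀ * Real.exp (-w x₀)) with ht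
    have hmin : ∀ x, -t ≤ ψ x * Real.exp (-w x) := fun x => by
      rw [ht, neg_neg]
      exact hx₀ (Set.mem_univ x)
    have hmul : ∀ x, ψ x * Real.exp (-w x) * Real.exp (w x) = ψ x := fun x => by
      rw [mul_assoc, ← Real.exp_add, neg_add_cancel, Real.exp_zero, mul_one]
    have ht0 : 0 ≤ t := by
      have := (hmin z).trans (mul_nonpos_of_nonpos_of_nonneg hz (Real.exp_pos _).le)
      linarith
    have hnonneg : ∀ x, 0 ≤ (ψ + t • expMap w) x := fun x => by
      have := mul_le_mul_of_nonneg_right (hmin x) (Real.exp_pos (w x)).le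
      rw [hmul] at this
      simp only [ContinuousMap.add_apply, ContinuousMap.smul_apply, expMap_apply, smul_eq_mul]
      linarith
    have htouch : t * Real.exp (w x₀) = -ψ x₀ := by
      rw [ht, neg_mul, hmul]
    have hpos : 0 ≤ ruelle p f ψ x₀ + t * ruelle p f (expMap w) x₀ := by
      have h := ruelle_mono (p := p) f (φ := 0) (ψ := ψ + t • expMap w) hnonneg x₀
      rw [ruelle_add, ruelle_smul] at h
      simpa [ruelle_apply] using h
    have hbound : t * ruelle p f (expMap w) x₀ ≤ Real.exp s * -ψ x₀ := by
      rw [← htouch]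
      have := mul_le_mul_of_nonneg_left (hw x₀) ht0
      linarith
    have hψx : (Real.exp s - l) * -ψ x₀ ≤ (Real.exp s - l) * ‖ψ‖ :=
      mul_le_mul_of_nonneg_left ((neg_le_abs _).trans (ψ.norm_coe_le_norm x₀))
        (sub_nonneg.2 (Real.exp_le_exp.2 hs.le))
    linarith [hgap x₀]

/-- Existence of an eigenprobability with eigenvalue `e^{P(f)}`, by separation of `0` from the
functions that lie strictly below some `L_f ψ - e^{P(f)} ψ`. -/
theorem exists_isDualEigen_exp_pressure (f : C(ℕ → M, ℝ)) :
    ∃ ν : ProbabilityMeasure (ℕ → M), IsDualEigen p f (Real.exp (pressure p f)) ν := by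
  set l := Real.exp (pressure p f) with hl
  let D : C(ℕ → M, ℝ) → C(ℕ → M, ℝ) := fun ψ => ruelle p f ψ - l • ψ
  let S : Set C(ℕ → M, ℝ) := {φ | ∃ ψ, ∀ x, φ x < D ψ x}
  have hconv : Convex ℝ S := by
    rintro φ₁ ⟨ψ₁, h₁⟩ φ₂ ⟨ψ₂, h₂⟩ a b ha hb hab
    refine ⟨a • ψ₁ + b • ψ₂, fun x => ?_⟩
    have hD : D (a • ψ₁ + b • ψ₂) x = a * D ψ₁ x + b * D ψ₂ x := by
      simp only [D, ruelle_add, ruelle_smul, ContinuousMap.sub_apply, ContinuousMap.add_apply,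
        ContinuousMap.smul_apply, smul_eq_mul]
      ring
    rw [hD]
    simp only [ContinuousMap.add_apply, ContinuousMap.smul_apply, smul_eq_mul]
    rcases ha.eq_or_lt with rfl | ha
    · obtain rfl : b = 1 := by linarith
      simpa using h₂ x
    · exact add_lt_add_of_lt_of_le (mul_lt_mul_of_pos_left (h₁ x) ha)
        (mul_le_mul_of_nonneg_left (h₂ x).le hb)
  have hopen : IsOpen S := by
    have : S = ⋃ ψ, {φ : C(ℕ → M, ℝ) | ∀ x, φ x < D ψ x} := by
      ext φ
      simp [S]
    rw [this]
    refine isOpen_iUnion fun ψ => ?_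
    have hset : {φ : C(ℕ → M, ℝ) | ∀ x, φ x < D ψ x} =
        (fun φ => D ψ - φ) ⁻¹' {η | Set.MapsTo η Set.univ (Set.Ioi (0 : ℝ))} := by
      ext φ
      simp [Set.MapsTo]
    rw [hset]
    exact (ContinuousMap.isOpen_setOfPred_mapsTo isCompact_univ isOpen_Ioi).preimage
      (continuous_const.sub continuous_id)
  have hlower : IsLowerSet S := fun φ₁ φ₂ hle ⟨ψ, h⟩ => ⟨ψ, fun x => (hle x).trans_lt (h x)⟩
  have hneg : ∀ ε : ℝ, 0 < ε → ∀ ψ, D ψ - ε • (1 : C(ℕ → M, ℝ)) ∈ S := fun ε hε ψ =>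
    ⟨ψ, fun x => by simpa using hε⟩
  have hzero : (0 : C(ℕ → M, ℝ)) ∉ S := by
    rintro ⟨ψ, h⟩
    obtain ⟨x, hx⟩ := exists_exp_pressure_mul_le_ruelle (p := p) f (-ψ)
    have := h x
    simp only [D, ContinuousMap.zero_apply, ContinuousMap.sub_apply, ContinuousMap.smul_apply,
      smul_eq_mul] at this
    simp only [ruelle_neg, ContinuousMap.neg_apply] at hx
    linarith
  obtain ⟨ν, hν⟩ := exists_probabilityMeasure_integral_neg hconv hopen hlower
    ⟨_, hneg 1 one_pos 0⟩ hzero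
  have hle : ∀ ψ, ∫ x, ruelle p f ψ x ∂(ν : Measure (ℕ → M)) ≤
      l * ∫ x, ψ x ∂(ν : Measure (ℕ → M)) := by
    intro ψ
    refine le_of_forall_pos_le_add fun ε hε => ?_
    have h := hν _ (hneg ε hε ψ)
    have hint := integrable_continuousMap (ν : Measure (ℕ → M))
    have h1 : ∫ x, (D ψ - ε • (1 : C(ℕ → M, ℝ))) x ∂(ν : Measure (ℕ → M)) =
        ∫ x, D ψ x ∂(ν : Measure (ℕ → M)) - ε :=
      (integral_sub (hint (D ψ)) (hint (ε • 1))).trans (by simp)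
    have h2 : ∫ x, D ψ x ∂(ν : Measure (ℕ → M)) =
        ∫ x, ruelle p f ψ x ∂(ν : Measure (ℕ → M)) - l * ∫ x, ψ x ∂(ν : Measure (ℕ → M)) :=
      (integral_sub (hint (ruelle p f ψ)) (hint (l • ψ))).trans (by simp [integral_const_mul])
    linarith
  refine ⟨ν, fun φ => le_antisymm (hle φ) ?_⟩
  have h := hle (-φ)
  simp only [ruelle_neg, ContinuousMap.neg_apply, integral_neg] at h
  linarith

/-- Integrating `L_f u ≤ e^s u` against an eigenprobability bounds its eigenvalue by `e^s`. -/
theorem IsDualEigen.le_exp_pressure {f : C(ℕ → M, ℝ)} {c : ℝ}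
    {ν : ProbabilityMeasure (ℕ → M)} (h : IsDualEigen p f c ν) :
    c ≤ Real.exp (pressure p f) := by
  rcases le_or_gt c 0 with hc | hc
  · exact hc.trans (Real.exp_pos _).le
  rw [← Real.log_le_iff_le_exp hc]
  refine le_pressure fun s w hw => ?_
  rw [isSubaction_iff] at hw
  rw [Real.log_le_iff_le_exp hc]
  have hint := integrable_continuousMap (ν : Measure (ℕ → M))
  have hle : c * ∫ x, expMap w x ∂(ν : Measure (ℕ → M)) ≤
      Real.exp s * ∫ x, expMap w x ∂(ν : Measure (ℕ → M)) := by
    rw [← h, ← integral_const_mul]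
    exact integral_mono (hint _) ((hint (expMap w)).const_mul _) hw
  exact le_of_mul_le_mul_right hle (integral_exp_pos (hint (expMap w)))

variable (p) in
theorem eigenvalue_eq_exp_pressure (f : C(ℕ → M, ℝ)) :
    eigenvalue p f = Real.exp (pressure p f) := by
  obtain ⟨ν, hν⟩ := exists_isDualEigen_exp_pressure (p := p) f
  have hmass : dualMass p f ν = Real.exp (pressure p f) := by
    simpa [dualMass] using hν 1
  refine IsGreatest.csSup_eq ⟨⟨ν, by rwa [hmass], hmass.symm⟩, ?_⟩
  rintro c ⟨ν', hν', rfl⟩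
  exact hν'.le_exp_pressure

variable (p) in
theorem log_eigenvalue (f : C(ℕ → M, ℝ)) : Real.log (eigenvalue p f) = pressure p f := by
  rw [eigenvalue_eq_exp_pressure, Real.log_exp]

end Eigenvalue

/-! ### Density of Hölder functions -/

section Density

variable {M : Type*} [MetricSpace M]

theorem distΩ_nonneg (x y : ℕ → M) : 0 ≤ distΩ x y :=
  tsum_nonneg fun _ => by positivity

variable [CompactSpace M]

theorem summable_distΩ (x y : ℕ → M) :
    Summable fun n : ℕ => (1 / 2 : ℝ) ^ (n + 1) * dist (x n) (y n) := by
  refine Summable.of_nonneg_of_le (fun n => by positivity)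
    (fun n => mul_le_mul_of_nonneg_left (Metric.dist_le_diam_of_mem isCompact_univ.isBounded
      (Set.mem_univ _) (Set.mem_univ _)) (by positivity)) (Summable.mul_right _ ?_)
  exact (summable_nat_add_iff 1).2 summable_geometric_two

theorem dist_apply_le_distΩ (x y : ℕ → M) (n : ℕ) :
    dist (x n) (y n) ≤ 2 ^ (n + 1) * distΩ x y := by
  have h := (summable_distΩ x y).le_tsum n fun _ _ => by positivity
  calc dist (x n) (y n) = 2 ^ (n + 1) * ((1 / 2 : ℝ) ^ (n + 1) * dist (x n) (y n)) := by
        rw [← mul_assoc, ← mul_pow]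
        norm_num
    _ ≤ _ := mul_le_mul_of_nonneg_left h (by positivity)

variable (M) in
/-- The algebra of `α`-Hölder functions on `M^ℕ`. -/
def holderSubalgebra (α : ℝ) : Subalgebra ℝ C(ℕ → M, ℝ) where
  carrier := holderClass M α
  add_mem' := by
    rintro φ ψ ⟨A, hA⟩ ⟨B, hB⟩
    refine ⟨A + B, fun x y => ?_⟩
    rw [add_mul, ContinuousMap.add_apply, ContinuousMap.add_apply, add_sub_add_comm]
    exact (abs_add_le _ _).trans (add_le_add (hA x y) (hB x y))
  mul_mem' := by
    rintro φ ψ ⟨A, hA⟩ ⟨B, hB⟩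
    refine ⟨‖φ‖ * B + ‖ψ‖ * A, fun x y => ?_⟩
    have h1 := φ.norm_coe_le_norm x
    have h2 := ψ.norm_coe_le_norm y
    rw [Real.norm_eq_abs] at h1 h2
    calc |φ x * ψ x - φ y * ψ y| = |φ x * (ψ x - ψ y) + ψ y * (φ x - φ y)| := by ring_nf
      _ ≤ |φ x| * |ψ x - ψ y| + |ψ y| * |φ x - φ y| := by
        rw [← abs_mul, ← abs_mul]
        exact abs_add_le _ _
      _ ≤ ‖φ‖ * (B * distΩ x y ^ α) + ‖ψ‖ * (A * distΩ x y ^ α) := by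
        gcongr
        · exact hB x y
        · exact hA x y
      _ = _ := by ring
  algebraMap_mem' r := ⟨0, fun x y => by simp⟩

/-- Since `M` is bounded, `|φ x - φ y| ≤ d(x_n, y_n)` makes `φ` Hölder of every exponent
`α ≤ 1`. -/
theorem mem_holderClass_of_abs_sub_le_dist {α : ℝ} (hα0 : 0 < α) (hα1 : α ≤ 1)
    {φ : C(ℕ → M, ℝ)} {n : ℕ} (h : ∀ x y, |φ x - φ y| ≤ dist (x n) (y n)) :
    φ ∈ holderClass M α := by
  set D := Metric.diam (Set.univ : Set M)
  refine ⟨D ^ (1 - α) * (2 ^ (n + 1) : ℝ) ^ α, fun x y => (h x y).trans ?_⟩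
  have hd0 : 0 ≤ dist (x n) (y n) := dist_nonneg
  have hdD : dist (x n) (y n) ≤ D :=
    Metric.dist_le_diam_of_mem isCompact_univ.isBounded (Set.mem_univ _) (Set.mem_univ _)
  calc dist (x n) (y n) = dist (x n) (y n) ^ (1 - α) * dist (x n) (y n) ^ α := by
        rw [← Real.rpow_add_of_nonneg hd0 (by linarith) hα0.le, sub_add_cancel, Real.rpow_one]
    _ ≤ D ^ (1 - α) * (2 ^ (n + 1) * distΩ x y) ^ α := by
        have hα1' : 0 ≤ 1 - α := by linarith
        gcongr
        exact dist_apply_le_distΩ x y n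
    _ = _ := by rw [Real.mul_rpow (by positivity) (distΩ_nonneg x y), mul_assoc]

theorem holderSubalgebra_separatesPoints {α : ℝ} (hα0 : 0 < α) (hα1 : α ≤ 1) :
    (holderSubalgebra M α).SeparatesPoints := by
  intro x y hxy
  obtain ⟨n, hn⟩ := Function.ne_iff.1 hxy
  let φ : C(ℕ → M, ℝ) := ⟨fun z => dist (z n) (y n), by fun_prop⟩
  refine ⟨φ, ⟨φ, mem_holderClass_of_abs_sub_le_dist (n := n) hα0 hα1 fun z w =>
    abs_dist_sub_le _ _ _, rfl⟩, ?_⟩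
  simpa [φ] using hn

theorem exists_mem_holderClass_norm_sub_lt {α : ℝ} (hα0 : 0 < α) (hα1 : α ≤ 1)
    (f : C(ℕ → M, ℝ)) {ε : ℝ} (hε : 0 < ε) : ∃ g ∈ holderClass M α, ‖g - f‖ < ε := by
  obtain ⟨g, hg⟩ := ContinuousMap.exists_mem_subalgebra_near_continuousMap_of_separatesPoints _
    (holderSubalgebra_separatesPoints hα0 hα1) f ε hε
  exact ⟨g, g.2, hg⟩

end Density

/-! ### Subgradients of the pressure -/

section Subgradient

variable {M : Type*} [MetricSpace M] [CompactSpace M] [MeasurableSpace M] [BorelSpace M]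
  (p : Measure M) [IsProbabilityMeasure p]

/-- `μ` is a subgradient of the pressure at `f`. -/
def IsPressureSubgradient (f : C(ℕ → M, ℝ)) (μ : ProbabilityMeasure (ℕ → M)) : Prop :=
  ∀ g : C(ℕ → M, ℝ), pressure p f + ∫ x, (g - f) x ∂(μ : Measure (ℕ → M)) ≤ pressure p g

variable {p} {f : C(ℕ → M, ℝ)} {μ : ProbabilityMeasure (ℕ → M)}

/-- Coboundaries have integral `0` because adding them to `f` does not increase the pressure. -/
theorem IsPressureSubgradient.mem_invariantMeasures (h : IsPressureSubgradient p f μ) :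
    μ ∈ invariantMeasures M := by
  have hshift : Continuous (shift : (ℕ → M) → ℕ → M) := continuous_shift
  have hint := integrable_continuousMap (μ : Measure (ℕ → M))
  have hle : ∀ ψ : C(ℕ → M, ℝ), ∫ x, ψ x ∂(μ : Measure (ℕ → M)) ≤
      ∫ x, ψ (shift x) ∂(μ : Measure (ℕ → M)) := by
    intro ψ
    have h1 := (h (f + coboundary ψ)).trans (pressure_add_coboundary_le f ψ)
    have h2 : ∫ x, (f + coboundary ψ - f) x ∂(μ : Measure (ℕ → M)) =
        ∫ x, ψ x ∂(μ : Measure (ℕ → M)) - ∫ x, ψ (shift x) ∂(μ : Measure (ℕ → M)) := by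
      rw [add_sub_cancel_left]
      exact integral_sub (hint ψ) (hint (ψ.comp ⟨shift, hshift⟩))
    linarith
  have heq : ∀ ψ : C(ℕ → M, ℝ), ∫ x, ψ (shift x) ∂(μ : Measure (ℕ → M)) =
      ∫ x, ψ x ∂(μ : Measure (ℕ → M)) := by
    intro ψ
    refine le_antisymm ?_ (hle ψ)
    have := hle (-ψ)
    simpa only [ContinuousMap.neg_apply, integral_neg, neg_le_neg_iff] using this
  refine ⟨hshift.measurable, ?_⟩
  have : IsProbabilityMeasure ((μ : Measure (ℕ → M)).map shift) :=
    Measure.isProbabilityMeasure_map hshift.aemeasurable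
  refine ext_of_forall_integral_eq_of_IsFiniteMeasure fun ψ => ?_
  rw [integral_map hshift.aemeasurable ψ.continuous.aestronglyMeasurable]
  exact heq ψ.toContinuousMap

theorem freeEnergy_le_pressure {α : ℝ} (hα0 : 0 < α) (hα1 : α ≤ 1) (f : C(ℕ → M, ℝ))
    (ρ : ProbabilityMeasure (ℕ → M)) : freeEnergy p α f ρ ≤ (pressure p f : EReal) := by
  have hint := integrable_continuousMap (ρ : Measure (ℕ → M))
  refine EReal.le_of_forall_lt_iff_le.1 fun r hr => ?_
  have hε : 0 < (r - pressure p f) / 2 := by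
    have := EReal.coe_lt_coe_iff.1 hr
    linarith
  obtain ⟨g, hg, hgf⟩ := exists_mem_holderClass_norm_sub_lt hα0 hα1 f hε
  have hent : entropy p α ρ ≤ ((-∫ x, g x ∂(ρ : Measure (ℕ → M)) + pressure p g : ℝ) : EReal) := by
    rw [← log_eigenvalue]
    exact iInf₂_le g hg
  refine (add_le_add_left hent _).trans ?_
  rw [← EReal.coe_add, EReal.coe_le_coe_iff]
  have h1 := pressure_le_add_norm (p := p) g f
  have h2 : ∫ x, f x ∂(ρ : Measure (ℕ → M)) - ∫ x, g x ∂(ρ : Measure (ℕ → M)) ≤ ‖g - f‖ := by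
    rw [← integral_sub (hint f) (hint g)]
    refine (integral_mono ((hint f).sub (hint g)) (integrable_const ‖g - f‖) fun x => ?_).trans
      (by simp)
    have := neg_le_of_abs_le ((g - f).norm_coe_le_norm x)
    simp only [ContinuousMap.sub_apply] at this
    simp only [Pi.sub_apply]
    linarith
  linarith

theorem IsPressureSubgradient.pressure_le_freeEnergy (h : IsPressureSubgradient p f μ) (α : ℝ) :
    (pressure p f : EReal) ≤ freeEnergy p α f μ := by
  have hint := integrable_continuousMap (μ : Measure (ℕ → M))
  have hent : ((pressure p f - ∫ x, f x ∂(μ : Measure (ℕ → M)) : ℝ) : EReal) ≤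
      entropy p α μ := by
    refine le_iInf₂ fun g _ => ?_
    rw [log_eigenvalue, EReal.coe_le_coe_iff]
    have := h g
    have h2 : ∫ x, (g - f) x ∂(μ : Measure (ℕ → M)) =
        ∫ x, g x ∂(μ : Measure (ℕ → M)) - ∫ x, f x ∂(μ : Measure (ℕ → M)) :=
      integral_sub (hint g) (hint f)
    linarith
  refine le_trans (le_of_eq ?_) (add_le_add_left hent _)
  rw [← EReal.coe_add, sub_add_cancel]

theorem IsPressureSubgradient.freeEnergy_eq (h : IsPressureSubgradient p f μ) {α : ℝ}
    (hα0 : 0 < α) (hα1 : α ≤ 1) : freeEnergy p α f μ = pressure p f :=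
  (freeEnergy_le_pressure hα0 hα1 f μ).antisymm (h.pressure_le_freeEnergy α)

/-- Existence of a subgradient, by separation of `0` from the convex set of all `φ` with
`P(f + φ) < P(f)`. -/
theorem exists_isPressureSubgradient (f : C(ℕ → M, ℝ)) :
    ∃ μ : ProbabilityMeasure (ℕ → M), IsPressureSubgradient p f μ := by
  let S : Set C(ℕ → M, ℝ) := {φ | pressure p (f + φ) < pressure p f}
  have hconv : Convex ℝ S := by
    have := ((convexOn_pressure p).translate_right f).convex_lt (pressure p f)
    simpa [S] using this
  have hopen : IsOpen S :=
    isOpen_lt ((lipschitzWith_pressure p).continuous.comp (continuous_const.add continuous_id))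
      continuous_const
  have hlower : IsLowerSet S := by
    intro φ₁ φ₂ hle hφ
    change pressure p (f + φ₁) < pressure p f at hφ
    have := pressure_le_add (p := p) (f := f + φ₂) (g := f + φ₁) (c := 0) fun x => by
      simpa using hle x
    change pressure p (f + φ₂) < pressure p f
    linarith
  have hmem : ∀ g : C(ℕ → M, ℝ), ∀ ε : ℝ, 0 < ε →
      g - f - (pressure p g - pressure p f + ε) • (1 : C(ℕ → M, ℝ)) ∈ S := by
    intro g ε hε
    have := pressure_le_add (p := p) (g := g)
      (f := f + (g - f - (pressure p g - pressure p f + ε) • (1 : C(ℕ → M, ℝ))))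
      (c := -(pressure p g - pressure p f + ε)) fun x => le_of_eq (by simp; ring)
    change pressure p
      (f + (g - f - (pressure p g - pressure p f + ε) • (1 : C(ℕ → M, ℝ)))) < pressure p f
    linarith
  obtain ⟨μ, hμ⟩ := exists_probabilityMeasure_integral_neg hconv hopen hlower
    ⟨_, hmem f 1 one_pos⟩ (by simp [S])
  refine ⟨μ, fun g => le_of_forall_pos_le_add fun ε hε => ?_⟩
  have h := hμ _ (hmem g ε hε)
  have heq : ∫ x, (g - f - (pressure p g - pressure p f + ε) • (1 : C(ℕ → M, ℝ))) x
      ∂(μ : Measure (ℕ → M)) =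
      ∫ x, (g - f) x ∂(μ : Measure (ℕ → M)) - (pressure p g - pressure p f + ε) := by
    refine (integral_sub (integrable_continuousMap _ (g - f))
      (integrable_continuousMap _ ((pressure p g - pressure p f + ε) • 1))).trans ?_
    simp
  linarith

theorem variationalPressure_eq_pressure {α : ℝ} (hα0 : 0 < α) (hα1 : α ≤ 1)
    (f : C(ℕ → M, ℝ)) : variationalPressure p α f = pressure p f := by
  obtain ⟨μ, hμ⟩ := exists_isPressureSubgradient (p := p) f
  refine le_antisymm (iSup₂_le fun ρ _ => freeEnergy_le_pressure hα0 hα1 f ρ) ?_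
  exact (hμ.pressure_le_freeEnergy α).trans
    (le_iSup₂ (f := fun ρ (_ : ρ ∈ invariantMeasures M) => freeEnergy p α f ρ) μ
      hμ.mem_invariantMeasures)

theorem IsPressureSubgradient.isEquilibriumState (h : IsPressureSubgradient p f μ) {α : ℝ}
    (hα0 : 0 < α) (hα1 : α ≤ 1) : IsEquilibriumState p α f μ :=
  ⟨h.mem_invariantMeasures, by
    rw [h.freeEnergy_eq hα0 hα1, variationalPressure_eq_pressure hα0 hα1]⟩

end Subgradient

/-! ### Weak limits of the measures `h ν` -/

section Limits

variable {M : Type*} [MetricSpace M] [CompactSpace M] [MeasurableSpace M] [BorelSpace M]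

/-- The probability measure `h ν`. -/
theorem exists_probabilityMeasure_integral_mul {h : C(ℕ → M, ℝ)}
    {ν : ProbabilityMeasure (ℕ → M)} (hpos : ∀ x, 0 < h x)
    (hone : ∫ x, h x ∂(ν : Measure (ℕ → M)) = 1) :
    ∃ μ : ProbabilityMeasure (ℕ → M), ∀ φ : C(ℕ → M, ℝ),
      ∫ x, φ x ∂(μ : Measure (ℕ → M)) = ∫ x, φ x * h x ∂(ν : Measure (ℕ → M)) := by
  have hprob : IsProbabilityMeasure
      ((ν : Measure (ℕ → M)).withDensity fun x => ENNReal.ofReal (h x)) := by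
    refine ⟨?_⟩
    rw [withDensity_apply _ MeasurableSet.univ, Measure.restrict_univ,
      ← ofReal_integral_eq_lintegral_ofReal (integrable_continuousMap _ h)
      (Eventually.of_forall fun x => (hpos x).le), hone, ENNReal.ofReal_one]
  refine ⟨⟨_, hprob⟩, fun φ => ?_⟩
  change ∫ x, φ x ∂((ν : Measure (ℕ → M)).withDensity fun x => ENNReal.ofReal (h x)) = _
  rw [integral_withDensity_eq_integral_toReal_smul h.continuous.measurable.ennreal_ofReal
    (Eventually.of_forall fun x => ENNReal.ofReal_lt_top)]
  refine integral_congr_ae (Eventually.of_forall fun x => ?_)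
  simp only [ENNReal.toReal_ofReal (hpos x).le, smul_eq_mul, mul_comm]

variable {p : Measure M} [IsProbabilityMeasure p] {f h : C(ℕ → M, ℝ)}
  {ν : ProbabilityMeasure (ℕ → M)}

/-- If `L_f h = λ_f h` and `L_f^* ν = λ_f ν`, then `h ν` is a subgradient of the pressure at `f`.
Given `L_g e^w ≤ e^s e^w`, the inequality `1 + z ≤ e^z`, applied to
`z = g - f + w - log h - K(x)` at the points `ax`, bounds `L_f (h (g - f + w - log h))(x)` by
`λ_f h(x) K(x)`, where `K = s - P(f) + w - log h`. Integrated against `ν`, the terms `w - log h`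
cancel. -/
theorem pressure_add_integral_sub_mul_le (hν : IsEigenprobability p f ν)
    (hh : IsMainEigenfunction p f h) (hone : ∫ x, h x ∂(ν : Measure (ℕ → M)) = 1)
    (g : C(ℕ → M, ℝ)) :
    pressure p f + ∫ x, (g - f) x * h x ∂(ν : Measure (ℕ → M)) ≤ pressure p g := by
  obtain ⟨hpos, heig⟩ := hh
  refine le_pressure fun s w hw => ?_
  rw [isSubaction_iff] at hw
  set c := eigenvalue p f with hc
  have hcexp : c = Real.exp (pressure p f) := eigenvalue_eq_exp_pressure p f
  have hc0 : 0 < c := hcexp ▸ Real.exp_pos _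
  let W : C(ℕ → M, ℝ) := g - f + w - logMap h hpos
  let K : C(ℕ → M, ℝ) := (s - pressure p f) • 1 + w - logMap h hpos
  have hpoint : ∀ x, ruelle p f (h * W) x ≤ c * (h x * K x) := by
    intro x
    have hle : ∀ a, Real.exp (f (prepend a x)) * (h * W + (1 - K x) • h) (prepend a x) ≤
        Real.exp (g (prepend a x)) * (Real.exp (-K x) • expMap w) (prepend a x) := by
      intro a
      set y := prepend a x
      have hexp : Real.exp (g y) * (Real.exp (-K x) * Real.exp (w y)) =
          Real.exp (f y) * (h y * Real.exp (W y - K x)) := by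
        rw [← Real.exp_log (hpos y), ← Real.exp_add, ← Real.exp_add, ← Real.exp_add,
          ← Real.exp_add]
        congr 1
        simp only [W, ContinuousMap.add_apply, ContinuousMap.sub_apply, logMap_apply]
        ring
      simp only [ContinuousMap.add_apply, ContinuousMap.mul_apply, ContinuousMap.smul_apply,
        smul_eq_mul, expMap_apply]
      rw [hexp]
      refine mul_le_mul_of_nonneg_left ?_ (Real.exp_pos _).le
      nlinarith [Real.add_one_le_exp (W y - K x), hpos y]
    have hint := integral_mono (integrable_exp_mul_prepend p f (h * W + (1 - K x) • h) x)
      (integrable_exp_mul_prepend p g (Real.exp (-K x) • expMap w) x) hle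
    rw [← ruelle_apply, ← ruelle_apply, ruelle_add, ruelle_smul, ruelle_smul, heig] at hint
    simp only [ContinuousMap.add_apply, ContinuousMap.smul_apply, smul_eq_mul] at hint
    have hK : Real.exp (-K x) * (Real.exp s * Real.exp (w x)) = c * h x := by
      rw [hcexp, ← Real.exp_log (hpos x), ← Real.exp_add, ← Real.exp_add, ← Real.exp_add]
      congr 1
      simp only [K, ContinuousMap.add_apply, ContinuousMap.sub_apply, ContinuousMap.smul_apply,
        ContinuousMap.one_apply, logMap_apply, smul_eq_mul]
      ring
    have := mul_le_mul_of_nonneg_left (hw x) (Real.exp_pos (-K x)).le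
    rw [hK] at this
    linarith
  have hint := integrable_continuousMap (ν : Measure (ℕ → M))
  have hWK : ∫ x, (h * W) x ∂(ν : Measure (ℕ → M)) ≤ ∫ x, (h * K) x ∂(ν : Measure (ℕ → M)) := by
    have := integral_mono (hint (ruelle p f (h * W))) ((hint (h * K)).const_mul c) hpoint
    rw [hν, integral_const_mul] at this
    exact le_of_mul_le_mul_left this hc0
  have hdiff : ∫ x, (h * W) x ∂(ν : Measure (ℕ → M)) - ∫ x, (h * K) x ∂(ν : Measure (ℕ → M)) =
      ∫ x, (g - f) x * h x ∂(ν : Measure (ℕ → M)) - (s - pressure p f) := by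
    have hmul : ∫ x, (s - pressure p f) * h x ∂(ν : Measure (ℕ → M)) = s - pressure p f := by
      rw [integral_const_mul, hone, mul_one]
    rw [← integral_sub (hint _) (hint _)]
    conv_rhs => rw [← hmul]
    refine Eq.trans ?_ (integral_sub (hint ((g - f) * h)) ((hint h).const_mul _))
    refine integral_congr_ae (Eventually.of_forall fun x => ?_)
    simp only [W, K, ContinuousMap.mul_apply, ContinuousMap.add_apply, ContinuousMap.sub_apply,
      ContinuousMap.smul_apply, ContinuousMap.one_apply, smul_eq_mul]
    ring
  linarith

theorem exists_isWeakClusterPoint {h : ℕ → C(ℕ → M, ℝ)} {ν : ℕ → ProbabilityMeasure (ℕ → M)}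
    (hpos : ∀ n x, 0 < h n x) (hone : ∀ n, ∫ x, h n x ∂(ν n : Measure (ℕ → M)) = 1) :
    ∃ μ : ProbabilityMeasure (ℕ → M), IsWeakClusterPoint h ν μ := by
  choose m hm using fun n => exists_probabilityMeasure_integral_mul (hpos n) (hone n)
  obtain ⟨μ, -, k, hk, hlim⟩ := isCompact_univ.tendsto_subseq fun n => Set.mem_univ (m n)
  refine ⟨μ, k, hk, fun φ => ?_⟩
  have := ProbabilityMeasure.tendsto_iff_forall_integral_tendsto.1 hlim
    (BoundedContinuousFunction.mkOfCompact φ)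
  simpa [hm] using this

/-- The subgradient inequality is closed under weak limits of measures with uniformly convergent
potentials, because the pressure is continuous. -/
theorem IsWeakClusterPoint.isPressureSubgradient {F h : ℕ → C(ℕ → M, ℝ)}
    {ν : ℕ → ProbabilityMeasure (ℕ → M)} {μ : ProbabilityMeasure (ℕ → M)}
    (hμ : IsWeakClusterPoint h ν μ) (hF : Tendsto (fun n => ‖F n - f‖) atTop (𝓝 0))
    (hν : ∀ n, IsEigenprobability p (F n) (ν n))
    (hh : ∀ n, IsMainEigenfunction p (F n) (h n))
    (hone : ∀ n, ∫ x, h n x ∂(ν n : Measure (ℕ → M)) = 1) :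
    IsPressureSubgradient p f μ := by
  obtain ⟨k, hk, hlim⟩ := hμ
  intro g
  have hFk : Tendsto (fun j => ‖F (k j) - f‖) atTop (𝓝 0) := hF.comp hk.tendsto_atTop
  -- Replacing `F (k j)` by `f` costs at most `‖F (k j) - f‖` in the pressure and in the integral.
  have hle : ∀ j, pressure p f + ∫ x, (g - f) x * h (k j) x ∂(ν (k j) : Measure (ℕ → M)) ≤
      pressure p g + 2 * ‖F (k j) - f‖ := by
    intro j
    have hint := integrable_continuousMap (ν (k j) : Measure (ℕ → M))
    have h1 := pressure_add_integral_sub_mul_le (hν (k j)) (hh (k j)) (hone (k j)) g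
    have h2 := pressure_le_add_norm (p := p) f (F (k j))
    rw [norm_sub_rev] at h2
    have h3 : ∫ x, (g - f) x * h (k j) x ∂(ν (k j) : Measure (ℕ → M)) ≤
        ∫ x, (g - F (k j)) x * h (k j) x ∂(ν (k j) : Measure (ℕ → M)) + ‖F (k j) - f‖ := by
      calc ∫ x, (g - f) x * h (k j) x ∂(ν (k j) : Measure (ℕ → M))
          ≤ ∫ x, ((g - F (k j)) x * h (k j) x + ‖F (k j) - f‖ * h (k j) x)
              ∂(ν (k j) : Measure (ℕ → M)) := by
            refine integral_mono (hint ((g - f) * h (k j)))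
              ((hint ((g - F (k j)) * h (k j))).add ((hint (h (k j))).const_mul _)) fun x => ?_
            have := (le_abs_self _).trans ((F (k j) - f).norm_coe_le_norm x)
            simp only [ContinuousMap.sub_apply] at this ⊢
            nlinarith [(hh (k j)).1 x]
        _ = _ := by
            refine (integral_add (hint ((g - F (k j)) * h (k j)))
              ((hint (h (k j))).const_mul _)).trans ?_
            rw [integral_const_mul, hone, mul_one]
            rfl
    linarith
  refine le_of_tendsto_of_tendsto' ((hlim (g - f)).const_add _) ?_ hle
  simpa using (hFk.const_mul 2).const_add (pressure p g)

end Limits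
end RuelleThermo

theorem mainTheorem11 {M : Type*} [MetricSpace M] [CompactSpace M] [MeasurableSpace M]
    [BorelSpace M] (p : Measure M) [IsProbabilityMeasure p] [p.IsOpenPosMeasure]
    (α : ℝ) (hα0 : 0 < α) (hα1 : α ≤ 1) (f : C(ℕ → M, ℝ)) :
    (∀ (F : ℕ → C(ℕ → M, ℝ)) (ν : ℕ → ProbabilityMeasure (ℕ → M)) (h : ℕ → C(ℕ → M, ℝ)),
      (∀ n, ∃ γ : ℝ, 0 < γ ∧ γ ≤ 1 ∧ F n ∈ RuelleThermo.holderClass M γ) →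
      Tendsto (fun n => ‖F n - f‖) atTop (𝓝 0) →
      (∀ n, RuelleThermo.IsEigenprobability p (F n) (ν n)) →
      (∀ n, RuelleThermo.IsMainEigenfunction p (F n) (h n)) →
      (∀ n, ∫ x, h n x ∂(ν n : Measure (ℕ → M)) = 1) →
      (∃ μ : ProbabilityMeasure (ℕ → M), RuelleThermo.IsWeakClusterPoint h ν μ) ∧
      ∀ μ : ProbabilityMeasure (ℕ → M), RuelleThermo.IsWeakClusterPoint h ν μ →
        RuelleThermo.IsEquilibriumState p α f μ) ∧
    ((Real.log (RuelleThermo.eigenvalue p f) : ℝ) : EReal) =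
      RuelleThermo.variationalPressure p α f := by
  refine ⟨fun F ν h _ hF hν hh hone => ⟨?_, fun μ hμ => ?_⟩, ?_⟩
  · exact RuelleThermo.exists_isWeakClusterPoint (fun n => (hh n).1) hone
  · exact (hμ.isPressureSubgradient hF hν hh hone).isEquilibriumState hα0 hα1
  · rw [RuelleThermo.log_eigenvalue, RuelleThermo.variationalPressure_eq_pressure hα0 hα1]
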